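/- Let $F=(F,\mathcal G_0,\nu)$ be a supertropical semifield: a commutative semiring with $0$, no nonzero elements of which have zero sum or zero product, with an ideal $\mathcal G_0\ni 0$ of ghosts and the ghost map $\nu(a)=a+a\in\mathcal G_0$, which is idempotent and multiplicative, such that $a+b=\nu(a)$ if $\nu(a)=\nu(b)$ and $a+b\in\{a,b\}$ otherwise, such that the set $\mathcal T=F\setminus\mathcal G_0$ of tangible elements is a multiplicative group, and such that $\nu$ maps $\mathcal T$ onto $\mathcal G_0\setminus\{0\}$. A vector of $F^{(n)}$ is tangible if each coordinate lies in $\mathcal T\cup\{0\}$, and ghost if each coordinate lies in $\mathcal G_0$. A family of vectors $(w_i)_{i\in I}$ of $F^{(n)}$ is tropically dependent if $\sum_{i\in I'}\alpha_i w_i$ is ghost for some nonempty finite $I'\subseteq I$ and some $\alpha_i\in\mathcal T$; otherwise it is tropically independent. A d-base of a subspace (submodule) $V\subseteq F^{(n)}$ is a maximal tropically independent subset of $V$, its rank is its number of elements, and $\operatorname{rk}(V)$ is the maximal rank of a d-base of $V$. A tropical subspace is a subspace $V$ that is tropically spanned by a set $S\subseteq V$ of tangible vectors, i.e. every element of $V$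 has the form $\sum_{i=1}^m\alpha_i s_i+u$ with $m\ge1$, $\alpha_i\in\mathcal T$, distinct $s_i\in S$ and $u$ a ghost vector. (1) If $w_1,\dots,w_k\in F^{(n)}$ ($k\ge1$) are tropically independent and $v\in F^{(n)}$ is a nonzero tangible vector, then for some $i$ the family obtained from $w_1,\dots,w_k$ by replacing $w_i$ with $v$ is tropically independent. (2) For any subspace $V$ of $F^{(n)}$ and any nonzero tangible $v\in V$, there is a set $B\ni v$ of tangible vectors of $V$ that is tropically independent and has the largest cardinality among all tropically independent sets of tangible vectors of $V$. (3) For any tropical subspace $V$ of $F^{(n)}$ and any nonzero tangible $v\in V$, there is a d-base of $V$ that consists of tangible vectors, contains $v$, and has rank $\operatorname{rk}(V)$. -/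

import Mathlib

/-- A (commutative) supertropical semifield `(F, ghost, ν)` with zero. Here `ghost` is the ghost
ideal together with the zero element, the ghost map is `ν a = a + a`, and the tangible elements
are those outside `ghost`. -/
class SupertropicalSemifield (F : Type*) extends CommSemiring F where
  /-- the ghost ideal, including `0` -/
  ghost : Ideal F
  /-- the nonzero elements are closed under addition -/
  eq_zero_of_add_eq_zero : ∀ a b : F, a + b = 0 → a = 0
  /-- the nonzero elements are closed under multiplication -/
  eq_zero_or_eq_zero_of_mul_eq_zero : ∀ a b : F, a * b = 0 → a = 0 ∨ b = 0
  /-- `ν` takes ghost values -/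
  nu_mem_ghost : ∀ a : F, a + a ∈ ghost
  /-- `ν` is idempotent -/
  nu_nu : ∀ a : F, (a + a) + (a + a) = a + a
  /-- `ν` is multiplicative -/
  nu_mul : ∀ a b : F, a * b + a * b = (a + a) * (b + b)
  /-- `a + b = ν a` if `ν a = ν b` -/
  add_of_nu_eq : ∀ a b : F, a + a = b + b → a + b = a + a
  /-- `a + b ∈ {a, b}` if `ν a ≠ ν b` -/
  add_of_nu_ne : ∀ a b : F, a + a ≠ b + b → a + b = a ∨ a + b = b
  /-- the tangible elements form a group under multiplication -/
  one_tangible : (1 : F) ∉ ghost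
  mul_tangible : ∀ a b : F, a ∉ ghost → b ∉ ghost → a * b ∉ ghost
  inv_tangible : ∀ a : F, a ∉ ghost → ∃ b : F, b ∉ ghost ∧ a * b = 1
  /-- `ν` maps the tangible elements onto the nonzero ghosts -/
  nu_onto : ∀ g : F, g ∈ ghost → g ≠ 0 → ∃ t : F, t ∉ ghost ∧ t + t = g

namespace Supertropical

variable {F : Type*} [SupertropicalSemifield F] {n : ℕ}

/-- Tangible scalars. -/
def IsTangible (a : F) : Prop := a ∉ SupertropicalSemifield.ghost (F := F)

/-- Tangible vectors of `F^(n)`: each coordinate is tangible or zero. -/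
def IsTangibleVec (v : Fin n → F) : Prop := ∀ i, v i = 0 ∨ IsTangible (v i)

/-- Ghost vectors of `F^(n)`: each coordinate is a ghost or zero. -/
def IsGhostVec (v : Fin n → F) : Prop := ∀ i, v i ∈ SupertropicalSemifield.ghost (F := F)

/-- A family of vectors is tropically dependent if some nonempty finite combination of its members
with tangible coefficients is a ghost vector. -/
def TropDependent {ι : Type*} (w : ι → Fin n → F) : Prop :=
  ∃ (s : Finset ι) (α : ι → F), s.Nonempty ∧ (∀ i ∈ s, IsTangible (α i)) ∧
    IsGhostVec (∑ i ∈ s, α i • w i)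

/-- A family of vectors is tropically independent if it is not tropically dependent. -/
def TropIndependent {ι : Type*} (w : ι → Fin n → F) : Prop := ¬ TropDependent w

/-- Tropical independence of a set of vectors. -/
def TropIndependentSet (S : Set (Fin n → F)) : Prop :=
  TropIndependent (fun x : S => (x : Fin n → F))

/-- A d-base of `V` is a maximal tropically independent subset of `V`. -/
def IsDBase (V : Submodule F (Fin n → F)) (B : Set (Fin n → F)) : Prop :=
  Maximal (fun S : Set (Fin n → F) => S ⊆ (V : Set (Fin n → F)) ∧ TropIndependentSet S) B

/-- The rank of `V`: the largest number of elements of a d-base of `V`. -/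
noncomputable def rk (V : Submodule F (Fin n → F)) : ℕ∞ :=
  ⨆ (B : Set (Fin n → F)) (_ : IsDBase V B), B.encard

/-- `v` is tropically spanned by `S`: it is the sum of a nonempty finite combination of elements
of `S` with tangible coefficients and of a ghost vector. -/
def TropSpanned (S : Set (Fin n → F)) (v : Fin n → F) : Prop :=
  ∃ (s : Finset (Fin n → F)) (α : (Fin n → F) → F) (u : Fin n → F),
    s.Nonempty ∧ (s : Set (Fin n → F)) ⊆ S ∧ (∀ w ∈ s, IsTangible (α w)) ∧ IsGhostVec u ∧
      v = ∑ w ∈ s, α w • w + u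

/-- A tropical subspace of `F^(n)`: a subspace that is tropically spanned by a set of tangible
vectors that it contains. -/
def IsTropicalSubspace (V : Submodule F (Fin n → F)) : Prop :=
  ∃ S : Set (Fin n → F), S ⊆ (V : Set (Fin n → F)) ∧ (∀ w ∈ S, IsTangibleVec w) ∧
    ∀ v ∈ V, TropSpanned S v

end Supertropical

/-! # Tangible d-bases of tropical subspaces over a supertropical semifield -/

open scoped NNReal

namespace Supertropical

open SupertropicalSemifield

/-! ### Ghosts as an ordered group with zero, and a dense value group. -/

section Ghosts

variable {F : Type*} [SupertropicalSemifield F]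

/-! The ghosts form a linearly ordered group with zero, and a sum is tangible only if one tangible
term strictly dominates the others in value. Everything rests on
`tropIndependent_iff_exists_isSeparating`: a finite family is independent exactly when nonzero
weights `x i` and columns `c i` exist such that `w i` is tangible at `c i` and, after weighting,
strictly dominates that column. The nontrivial direction is a theorem of the alternative for
max-times systems, `exists_subsolution_or_supersolution`, whose other outcome yields a dependence.

Given a separation, exchange is an explicit choice of row, column and weight for `v`. In a tropical
subspace, each `w i` can be replaced by the tangible summand that produces its entry at `c i`: that
entry is unchanged and no other value grows, so the same weights still separate. Hence tangible
independent sets already attain the rank. -/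

theorem add_self_of_mem_ghost {g : F} (hg : g ∈ ghost (F := F)) : g + g = g := by
  by_cases h : g = 0
  · simp [h]
  · obtain ⟨t, -, rfl⟩ := nu_onto g hg h
    exact nu_nu t

variable (F) in
/-- The ghosts of `F`, together with zero. -/
def Ghost : Type _ := {g : F // g ∈ ghost (F := F)}

namespace Ghost

@[ext] theorem ext {g h : Ghost F} (e : g.1 = h.1) : g = h := Subtype.ext e

theorem add_self (g : Ghost F) : g.1 + g.1 = g.1 := add_self_of_mem_ghost g.2

theorem add_eq_or (g h : Ghost F) : g.1 + h.1 = g.1 ∨ g.1 + h.1 = h.1 := by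
  by_cases e : g.1 = h.1
  · left; rw [← e, add_self]
  · exact add_of_nu_ne _ _ (by rwa [add_self, add_self])

/-- Two ghosts add up to one of them, so addition is the maximum for this order. -/
noncomputable instance : LinearOrder (Ghost F) where
  le g h := g.1 + h.1 = h.1
  le_refl g := g.add_self
  le_trans a b c hab hbc := by
    rw [← hbc, ← add_assoc, show a.1 + b.1 = b.1 from hab]
  le_antisymm a b hab hba := by
    apply ext
    rw [← show a.1 + b.1 = b.1 from hab, add_comm, show b.1 + a.1 = a.1 from hba]
  le_total a b := by
    rw [add_comm b.1]
    exact (add_eq_or a b).symm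
  toDecidableLE := Classical.decRel _

theorem le_def {g h : Ghost F} : g ≤ h ↔ g.1 + h.1 = h.1 := Iff.rfl

theorem exists_inverse (g : Ghost F) (hg : g.1 ≠ 0) : ∃ h : Ghost F, g.1 * h.1 = 1 + 1 := by
  obtain ⟨t, ht, e⟩ := nu_onto g.1 g.2 hg
  obtain ⟨b, -, hb⟩ := inv_tangible t ht
  exact ⟨⟨b + b, nu_mem_ghost b⟩, by rw [← e, ← nu_mul, hb]⟩

instance : CommMonoidWithZero (Ghost F) where
  mul g h := ⟨g.1 * h.1, Ideal.mul_mem_left _ _ h.2⟩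
  one := ⟨1 + 1, nu_mem_ghost 1⟩
  zero := ⟨0, Ideal.zero_mem _⟩
  mul_assoc a b c := ext (mul_assoc a.1 b.1 c.1)
  mul_comm a b := ext (mul_comm a.1 b.1)
  one_mul a := ext (show (1 + 1) * a.1 = a.1 by rw [add_mul, one_mul, add_self])
  mul_one a := ext (show a.1 * (1 + 1) = a.1 by rw [mul_add, mul_one, add_self])
  zero_mul a := ext (zero_mul a.1)
  mul_zero a := ext (mul_zero a.1)

theorem coe_mul (g h : Ghost F) : (g * h).1 = g.1 * h.1 := rfl

theorem coe_ne_zero {g : Ghost F} (hg : g ≠ 0) : g.1 ≠ 0 := fun h => hg (ext h)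

open Classical in
noncomputable instance : CommGroupWithZero (Ghost F) where
  inv g := if h : g.1 = 0 then 0 else (exists_inverse g h).choose
  exists_pair_ne := ⟨0, 1, fun h => by
    have : (0 : F) = 1 + 1 := congrArg Subtype.val h
    have h1 : (1 : F) = 0 := eq_zero_of_add_eq_zero _ _ this.symm
    exact one_tangible (F := F) (h1 ▸ Ideal.zero_mem _)⟩
  inv_zero := dif_pos rfl
  mul_inv_cancel g hg := by
    apply ext
    have h := coe_ne_zero hg
    change g.1 * (if h : g.1 = 0 then (0 : Ghost F) else (exists_inverse g h).choose).1 = 1 + 1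
    rw [dif_neg h]
    exact (exists_inverse g h).choose_spec

instance : PosMulStrictMono (Ghost F) :=
  have : PosMulMono (Ghost F) := ⟨fun a _ b c h => by
    rw [le_def] at h
    change (a * b).1 + (a * c).1 = (a * c).1
    rw [coe_mul, coe_mul, ← mul_add, h]⟩
  PosMulMono.toPosMulStrictMono

noncomputable instance : LinearOrderedCommGroupWithZero (Ghost F) where
  bot := 0
  bot_le g := zero_add g.1
  isBot_zero g := zero_add g.1

end Ghost

theorem IsTangible.ne_zero {a : F} (ha : IsTangible a) : a ≠ 0 := by
  rintro rfl
  exact ha (Ideal.zero_mem _)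

theorem isTangible_mul {a b : F} : IsTangible (a * b) ↔ IsTangible a ∧ IsTangible b :=
  ⟨fun h => ⟨fun ha => h (Ideal.mul_mem_right _ _ ha), fun hb => h (Ideal.mul_mem_left _ _ hb)⟩,
    fun h => mul_tangible a b h.1 h.2⟩

variable (F) in
/-- The ghost map, as a homomorphism to the linearly ordered group with zero of ghosts. -/
def ghostMap : F →*₀ Ghost F where
  toFun a := ⟨a + a, nu_mem_ghost a⟩
  map_zero' := Ghost.ext (add_zero 0)
  map_one' := rfl
  map_mul' a b := Ghost.ext (nu_mul a b)

theorem ghostMap_coe (a : F) : (ghostMap F a).1 = a + a := rfl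

variable (F) in
/-- A densely ordered group with zero that contains the ghosts of `F`, with a monotone
retraction onto them. -/
abbrev ValueGroup : Type _ := WithZero ((Ghost F)ˣ ×ₗ ℝ≥0ˣ)

variable (F) in
/-- The ghost map with values in the densely ordered group with zero `ValueGroup F`. -/
noncomputable def val : F →*₀ ValueGroup F :=
  (LinearOrderedCommGroupWithZero.inl (Ghost F) ℝ≥0).toMonoidWithZeroHom.comp (ghostMap F)

variable (F) in
/-- The monotone retraction of `ValueGroup F` onto the ghosts. -/
noncomputable def toGhost : ValueGroup F →*₀o Ghost F :=
  LinearOrderedCommGroupWithZero.fst (Ghost F) ℝ≥0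

theorem toGhost_val (a : F) : toGhost F (val F a) = ghostMap F a :=
  DFunLike.congr_fun (LinearOrderedCommGroupWithZero.fst_comp_inl (Ghost F) ℝ≥0) (ghostMap F a)

theorem val_le_val {a b : F} : val F a ≤ val F b ↔ ghostMap F a ≤ ghostMap F b :=
  ⟨fun h => by simpa only [toGhost_val] using OrderHomClass.mono (toGhost F) h,
    fun h => OrderHomClass.mono (LinearOrderedCommGroupWithZero.inl (Ghost F) ℝ≥0) h⟩

theorem val_lt_val {a b : F} : val F a < val F b ↔ ghostMap F a < ghostMap F b := by
  rw [← not_le, val_le_val, not_le]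

theorem val_eq_val {a b : F} : val F a = val F b ↔ a + a = b + b := by
  rw [le_antisymm_iff, val_le_val, val_le_val, ← le_antisymm_iff]
  exact ⟨fun h => congrArg Subtype.val h, fun h => Ghost.ext h⟩

theorem val_eq_zero {a : F} : val F a = 0 ↔ a = 0 := by
  rw [← map_zero (val F), val_eq_val, add_zero]
  exact ⟨fun h => eq_zero_of_add_eq_zero _ _ h, fun h => by rw [h, add_zero]⟩

theorem add_mem_ghost_of_val_eq {a b : F} (h : val F a = val F b) : a + b ∈ ghost (F := F) := by
  rw [add_of_nu_eq a b (val_eq_val.1 h)]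
  exact nu_mem_ghost a

theorem val_le_val_add_left (a b : F) : val F a ≤ val F (a + b) := by
  rw [val_le_val, Ghost.le_def, ghostMap_coe, ghostMap_coe, add_add_add_comm a b a b, ← add_assoc,
    nu_nu]

theorem add_eq_left_of_val_lt {a b : F} (h : val F b < val F a) : a + b = a := by
  refine (add_of_nu_ne a b fun e => h.ne' (val_eq_val.2 e)).resolve_right fun e => ?_
  exact h.not_ge (e ▸ val_le_val_add_left a b)

theorem add_eq_right_of_val_lt {a b : F} (h : val F a < val F b) : a + b = b := by
  rw [add_comm, add_eq_left_of_val_lt h]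

theorem exists_isTangible_ghostMap_eq {g : Ghost F} (hg : g ≠ 0) :
    ∃ t : F, IsTangible t ∧ ghostMap F t = g := by
  obtain ⟨t, ht, e⟩ := nu_onto g.1 g.2 (Ghost.coe_ne_zero hg)
  exact ⟨t, ht, Ghost.ext e⟩

theorem val_le_val_sum {ι : Type*} {s : Finset ι} (f : ι → F) {i : ι} (hi : i ∈ s) :
    val F (f i) ≤ val F (∑ j ∈ s, f j) := by
  classical
  rw [← Finset.add_sum_erase s f hi]
  exact val_le_val_add_left _ _

/-- A sum with a strictly dominant term is equal to this term. -/
theorem sum_eq_of_val_lt {ι : Type*} {s : Finset ι} {f : ι → F} {i : ι} (hi : i ∈ s)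
    (hlt : ∀ j ∈ s, j ≠ i → val F (f j) < val F (f i)) (h0 : f i ≠ 0) : ∑ j ∈ s, f j = f i := by
  classical
  have key : ∀ t : Finset ι, (∀ j ∈ t, val F (f j) < val F (f i)) →
      val F (∑ j ∈ t, f j) < val F (f i) := by
    intro t
    induction t using Finset.induction_on with
    | empty =>
      intro _
      rw [Finset.sum_empty, map_zero]
      exact zero_lt_iff.2 fun h => h0 (val_eq_zero.1 h)
    | insert k t hk ih =>
      intro h
      rw [Finset.sum_insert hk]
      have h1 := h k (Finset.mem_insert_self k t)
      have h2 := ih fun j hj => h j (Finset.mem_insert_of_mem hj)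
      rcases lt_trichotomy (val F (f k)) (val F (∑ j ∈ t, f j)) with e | e | e
      · rwa [add_eq_right_of_val_lt e]
      · rw [add_of_nu_eq _ _ (val_eq_val.1 e)]
        rwa [val_eq_val.2 (nu_nu (f k))]
      · rwa [add_eq_left_of_val_lt e]
  rw [← Finset.add_sum_erase s f hi]
  exact add_eq_left_of_val_lt (key _ fun j hj =>
    hlt j (Finset.mem_of_mem_erase hj) (Finset.ne_of_mem_erase hj))

/-- A tangible sum has a strictly dominant term and is equal to this term. -/
theorem exists_dominant_of_isTangible_sum {ι : Type*} {s : Finset ι} {f : ι → F}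
    (h : IsTangible (∑ j ∈ s, f j)) :
    ∃ i ∈ s, ∑ j ∈ s, f j = f i ∧ ∀ j ∈ s, j ≠ i → val F (f j) < val F (f i) := by
  classical
  induction s using Finset.induction_on with
  | empty => exact absurd rfl h.ne_zero
  | insert k t hk ih =>
    rw [Finset.sum_insert hk] at h ⊢
    rcases lt_trichotomy (val F (f k)) (val F (∑ j ∈ t, f j)) with e | e | e
    · rw [add_eq_right_of_val_lt e] at h ⊢
      obtain ⟨i, hi, hs, hlt⟩ := ih h
      refine ⟨i, Finset.mem_insert_of_mem hi, hs, fun j hj hji => ?_⟩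
      obtain rfl | hj := Finset.mem_insert.1 hj
      · rwa [← hs]
      · exact hlt j hj hji
    · exact absurd (add_mem_ghost_of_val_eq e) h
    · rw [add_eq_left_of_val_lt e]
      refine ⟨k, Finset.mem_insert_self k t, rfl, fun j hj hjk => ?_⟩
      exact (val_le_val_sum f ((Finset.mem_insert.1 hj).resolve_left hjk)).trans_lt e

/-- The real factor, second in the lexicographic order, supplies density even when the ghosts are
discrete. Strict inequalities between weights then always leave room. -/
instance : DenselyOrdered (ValueGroup F) :=
  inferInstance

end Ghosts

/-! ### Theorems of the alternative for max-times systems. -/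

section Alternative

variable {Γ : Type*} [LinearOrderedCommGroupWithZero Γ] {ι κ : Type*}

/-- Supplies a new nonzero weight subject to strict lower and upper bounds. With no upper bounds,
density below `1` gives an `e < 1` by which to divide. -/
theorem exists_ne_zero_between [DenselyOrdered Γ] (s t : Finset ι) (f g : ι → Γ)
    (h : ∀ i ∈ s, ∀ j ∈ t, f i < g j) (hg : ∀ j ∈ t, 0 < g j) :
    ∃ y : Γ, y ≠ 0 ∧ (∀ i ∈ s, f i < y) ∧ ∀ j ∈ t, y < g j := by
  have key : ∃ y, s.sup f < y ∧ ∀ j ∈ t, y < g j := by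
    obtain rfl | ht := t.eq_empty_or_nonempty
    · obtain h0 | h0 := eq_or_ne (s.sup f) 0
      · exact ⟨1, h0 ▸ zero_lt_one, by simp⟩
      · obtain ⟨e, he0, he1⟩ := exists_between (zero_lt_one (α := Γ))
        refine ⟨s.sup f / e, ?_, by simp⟩
        rw [lt_div_iff₀ he0]
        exact mul_lt_of_lt_one_right (zero_lt_iff.2 h0) he1
    · have hlt : s.sup f < t.inf' ht g := by
        rw [Finset.lt_inf'_iff]
        intro j hj
        rw [Finset.sup_lt_iff (by rw [bot_eq_zero]; exact hg j hj)]
        exact fun i hi => h i hi j hj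
      obtain ⟨y, h1, h2⟩ := exists_between hlt
      exact ⟨y, h1, fun j hj => h2.trans_le (Finset.inf'_le g hj)⟩
  obtain ⟨y, h1, h2⟩ := key
  exact ⟨y, (zero_le.trans_lt h1).ne', fun i hi => (Finset.le_sup hi).trans_lt h1, h2⟩

/-- For a max-times linear operator there is either a nonzero vector that it does not decrease, or
a vector with nonzero coordinates that it strictly decreases. -/
theorem exists_subsolution_or_supersolution_of_linear [DenselyOrdered Γ] (s : Finset ι) (b : ι → ι → Γ) :
    (∃ x : ι → Γ, (∃ i ∈ s, x i ≠ 0) ∧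
      ∀ i ∈ s, x i ≠ 0 → ∃ r ∈ s, x i ≤ b i r * x r) ∨
    ∃ x : ι → Γ, (∀ i ∈ s, x i ≠ 0) ∧ ∀ i ∈ s, ∀ r ∈ s, b i r * x r < x i := by
  classical
  induction s using Finset.induction_on generalizing b with
  | empty => exact Or.inr ⟨0, by simp, by simp⟩
  | insert i s hi ih =>
    by_cases hb : 1 ≤ b i i
    · refine Or.inl ⟨Pi.single i 1, ⟨i, by simp⟩, fun j _ hj => ⟨i, by simp, ?_⟩⟩
      obtain rfl : j = i := by
        by_contra h
        exact hj (Pi.single_eq_of_ne h 1)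
      simpa using hb
    rw [not_le] at hb
    have ne {j : ι} (hj : j ∈ s) : j ≠ i := fun h => hi (h ▸ hj)
    -- Eliminate the variable `i`: a step from `j` to `r` is either direct or passes through `i`.
    rcases ih fun j r => max (b j r) (b j i * b i r) with ⟨x, ⟨k, hk, hxk⟩, hx⟩ | ⟨x, hx0, hx⟩
    · left
      refine ⟨Function.update x i (s.sup fun r => b i r * x r),
        ⟨k, Finset.mem_insert_of_mem hk, by rwa [Function.update_of_ne (ne hk)]⟩, ?_⟩
      intro j hj hj0
      obtain rfl | hj := Finset.mem_insert.1 hj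
      · obtain ⟨r, hr, e⟩ := Finset.exists_mem_eq_sup s ⟨k, hk⟩ fun r => b j r * x r
        refine ⟨r, Finset.mem_insert_of_mem hr, ?_⟩
        rw [Function.update_self, Function.update_of_ne (ne hr), e]
      · rw [Function.update_of_ne (ne hj)] at hj0 ⊢
        obtain ⟨r, hr, h⟩ := hx j hj hj0
        rcases le_total (b j i * b i r) (b j r) with e | e
        · rw [max_eq_left e] at h
          exact ⟨r, Finset.mem_insert_of_mem hr, by rwa [Function.update_of_ne (ne hr)]⟩
        · rw [max_eq_right e, mul_assoc] at h
          refine ⟨i, Finset.mem_insert_self i s, h.trans ?_⟩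
          rw [Function.update_self]
          exact mul_le_mul_right (Finset.le_sup (f := fun r => b i r * x r) hr) _
    · right
      -- The weight at `i` must exceed every `b i r * x r` and stay below every `x j / b j i`; the
      -- reduced inequalities say precisely that these bounds are compatible.
      obtain ⟨y, hy0, hy1, hy2⟩ := exists_ne_zero_between s (s.filter fun j => b j i ≠ 0)
        (fun r => b i r * x r) (fun j => x j / b j i)
        (fun r hr j hj => by
          rw [Finset.mem_filter] at hj
          rw [lt_div_iff₀ (zero_lt_iff.2 hj.2), mul_comm, ← mul_assoc]
          exact (mul_le_mul_left (le_max_right _ _) _).trans_lt (hx j hj.1 r hr))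
        (fun j hj => by
          rw [Finset.mem_filter] at hj
          exact zero_lt_iff.2 (div_ne_zero (hx0 j hj.1) hj.2))
      refine ⟨Function.update x i y, fun j hj => ?_, fun j hj r hr => ?_⟩
      · obtain rfl | hj := Finset.mem_insert.1 hj
        · rwa [Function.update_self]
        · rw [Function.update_of_ne (ne hj)]
          exact hx0 j hj
      · obtain rfl | hj' := Finset.mem_insert.1 hj <;> obtain rfl | hr' := Finset.mem_insert.1 hr
        · rw [Function.update_self]
          exact mul_lt_of_lt_one_left (zero_lt_iff.2 hy0) hb
        · rw [Function.update_self, Function.update_of_ne (ne hr')]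
          exact hy1 r hr'
        · rw [Function.update_self, Function.update_of_ne (ne hj')]
          by_cases h0 : b j r = 0
          · rw [h0, zero_mul]
            exact zero_lt_iff.2 (hx0 j hj')
          · rw [mul_comm, ← lt_div_iff₀ (zero_lt_iff.2 h0)]
            exact hy2 j (Finset.mem_filter.2 ⟨hj', h0⟩)
        · rw [Function.update_of_ne (ne hj'), Function.update_of_ne (ne hr')]
          exact (mul_le_mul_left (le_max_left _ _) _).trans_lt (hx j hj' r hr')

/-- Two vectors satisfying conditions of the same kind, for the action sets `C` and `D` at `i` and
the same action sets elsewhere, combine to one that satisfies them for the union of the sets. -/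
theorem exists_subsolution_union [DecidableEq ι] [DecidableEq κ] (a : ι → κ → Γ)
    (A : ι → Finset κ) (i : ι) (C D : Finset κ) (hA : A i = C ∪ D)
    (hC : ∃ x : ι → Γ, (∃ j, x j ≠ 0) ∧ ∀ j, x j ≠ 0 → ∀ c ∈ Function.update A i C j,
      ∃ r, r ≠ j ∧ x j * a j c ≤ x r * a r c)
    (hD : ∃ x : ι → Γ, (∃ j, x j ≠ 0) ∧ ∀ j, x j ≠ 0 → ∀ c ∈ Function.update A i D j,
      ∃ r, r ≠ j ∧ x j * a j c ≤ x r * a r c) :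
    ∃ x : ι → Γ, (∃ j, x j ≠ 0) ∧ ∀ j, x j ≠ 0 → ∀ c ∈ A j,
      ∃ r, r ≠ j ∧ x j * a j c ≤ x r * a r c := by
  obtain ⟨x, hx0, hx⟩ := hC
  obtain ⟨y, hy0, hy⟩ := hD
  -- A vector vanishing at `i` imposes nothing there, so the choice of action set at `i` is
  -- irrelevant.
  by_cases hxi : x i = 0
  · refine ⟨x, hx0, fun j hj => ?_⟩
    have hji : j ≠ i := by rintro rfl; exact hj hxi
    simpa only [Function.update_of_ne hji] using hx j hj
  by_cases hyi : y i = 0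
  · refine ⟨y, hy0, fun j hj => ?_⟩
    have hji : j ≠ i := by rintro rfl; exact hj hyi
    simpa only [Function.update_of_ne hji] using hy j hj
  -- Both vectors are scaled to be `1` at `i`, so `z` inherits the conditions of both there.
  -- Elsewhere `z j` comes from one of them, and enlarging the other coordinates only helps.
  let z : ι → Γ := fun j => max (x j / x i) (y j / y i)
  have hxz (j c) (h : ∃ r, r ≠ j ∧ x j * a j c ≤ x r * a r c) :
      ∃ r, r ≠ j ∧ x j / x i * a j c ≤ z r * a r c := by
    obtain ⟨r, hr, h⟩ := h
    refine ⟨r, hr, le_trans ?_ (mul_le_mul_left (le_max_left _ _) _)⟩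
    rw [div_mul_eq_mul_div, div_mul_eq_mul_div]
    exact div_le_div_of_nonneg_right h zero_le
  have hyz (j c) (h : ∃ r, r ≠ j ∧ y j * a j c ≤ y r * a r c) :
      ∃ r, r ≠ j ∧ y j / y i * a j c ≤ z r * a r c := by
    obtain ⟨r, hr, h⟩ := h
    refine ⟨r, hr, le_trans ?_ (mul_le_mul_left (le_max_right _ _) _)⟩
    rw [div_mul_eq_mul_div, div_mul_eq_mul_div]
    exact div_le_div_of_nonneg_right h zero_le
  have hzi : z i = 1 := by simp only [z, div_self hxi, div_self hyi, max_self]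
  refine ⟨z, ⟨i, by rw [hzi]; exact one_ne_zero⟩, fun j hj c hc => ?_⟩
  by_cases hji : j = i
  · subst hji
    rw [hA, Finset.mem_union] at hc
    rw [hzi]
    rcases hc with hc | hc
    · have := hxz j c (hx j hxi c (by rwa [Function.update_self]))
      rwa [div_self hxi] at this
    · have := hyz j c (hy j hyi c (by rwa [Function.update_self]))
      rwa [div_self hyi] at this
  · rcases le_total (x j / x i) (y j / y i) with e | e
    · have hz : z j = y j / y i := max_eq_right e
      rw [hz] at hj ⊢
      exact hyz j c (hy j (fun h => hj (by rw [h, zero_div])) c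
        (by rwa [Function.update_of_ne hji]))
    · have hz : z j = x j / x i := max_eq_left e
      rw [hz] at hj ⊢
      exact hxz j c (hx j (fun h => hj (by rw [h, zero_div])) c
        (by rwa [Function.update_of_ne hji]))

/-- The alternative for min-max operators: either some nonzero vector `x` of weights of the rows
of `a` makes no allowed entry strictly dominant in its column, or for some weights each row has an
allowed entry that is. -/
theorem exists_subsolution_or_supersolution [DenselyOrdered Γ] [Fintype ι] [Finite κ]
    (a : ι → κ → Γ) (A : ι → Finset κ) (hA : ∀ i, ∀ c ∈ A i, a i c ≠ 0) :
    (∃ x : ι → Γ, (∃ j, x j ≠ 0) ∧ ∀ j, x j ≠ 0 → ∀ c ∈ A j,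
      ∃ r, r ≠ j ∧ x j * a j c ≤ x r * a r c) ∨
    ∃ (c : ι → κ) (x : ι → Γ), (∀ i, c i ∈ A i) ∧ (∀ i, x i ≠ 0) ∧
      ∀ i r, r ≠ i → x r * a r (c i) < x i * a i (c i) := by
  classical
  induction A using WellFoundedLT.induction with
  | ind A ih =>
  -- A row with several allowed columns is split into two smaller problems. Dominating weights for
  -- either one suffice; otherwise the two subsolutions combine.
  by_cases hsplit : ∃ i, ∃ c ∈ A i, ∃ d ∈ A i, c ≠ d
  · obtain ⟨i, c, hc, d, hd, hcd⟩ := hsplit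
    have step (C : Finset κ) (hC : C ⊂ A i) :=
      ih (Function.update A i C) (update_lt_self_iff.2 hC) (fun j e he => by
        by_cases hji : j = i
        · subst hji
          rw [Function.update_self] at he
          exact hA j e (hC.1 he)
        · rw [Function.update_of_ne hji] at he
          exact hA j e he)
    have mono (C : Finset κ) (hC : C ⊂ A i) (j : ι) : Function.update A i C j ⊆ A j :=
      (update_lt_self_iff.2 hC).le j
    have h1 : (A i).erase c ⊂ A i := Finset.erase_ssubset hc
    have h2 : {c} ⊂ A i := by
      refine (Finset.ssubset_iff_of_subset (Finset.singleton_subset_iff.2 hc)).2 ⟨d, hd, ?_⟩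
      rw [Finset.mem_singleton]
      exact hcd.symm
    rcases step _ h1 with hx | ⟨e, x, he, h⟩
    · rcases step _ h2 with hy | ⟨e, x, he, h⟩
      · refine Or.inl (exists_subsolution_union a A i _ _ ?_ hx hy)
        rw [Finset.union_comm, ← Finset.insert_eq, Finset.insert_erase hc]
      · exact Or.inr ⟨e, x, fun j => mono _ h2 j (he j), h⟩
    · exact Or.inr ⟨e, x, fun j => mono _ h1 j (he j), h⟩
  by_cases hempty : ∃ i, A i = ∅
  · obtain ⟨i, hi⟩ := hempty
    refine Or.inl ⟨Pi.single i 1, ⟨i, by simp⟩, fun j hj c hc => ?_⟩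
    by_cases hji : j = i
    · subst hji
      simp [hi] at hc
    · exact absurd (Pi.single_eq_of_ne hji 1) hj
  push Not at hsplit hempty
  choose c hc using hempty
  -- With one column per row the problem is linear; the zero diagonal encodes the condition `r ≠ i`.
  rcases exists_subsolution_or_supersolution_of_linear Finset.univ
    (fun i r => if r = i then 0 else a r (c i) / a i (c i)) with ⟨x, ⟨k, -, hk⟩, hx⟩ | ⟨x, hx0, hx⟩
  · refine Or.inl ⟨x, ⟨k, hk⟩, fun j hj d hd => ?_⟩
    obtain rfl := hsplit j d hd (c j) (hc j)
    obtain ⟨r, -, h⟩ := hx j (Finset.mem_univ j) hj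
    by_cases hr : r = j
    · rw [if_pos hr, zero_mul] at h
      exact absurd (le_zero_iff.1 h) hj
    · refine ⟨r, hr, ?_⟩
      rwa [if_neg hr, div_mul_eq_mul_div, le_div_iff₀ (zero_lt_iff.2 (hA j _ hd)),
        mul_comm (a r _)] at h
  · refine Or.inr ⟨c, x, hc, fun i => hx0 i (Finset.mem_univ i), fun i r hr => ?_⟩
    have h := hx i (Finset.mem_univ i) r (Finset.mem_univ r)
    rwa [if_neg hr, div_mul_eq_mul_div, div_lt_iff₀ (zero_lt_iff.2 (hA i _ (hc i))),
      mul_comm (a r _)] at h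

end Alternative

/-! ### Separating weights, exchange and d-bases. -/

section Independence

variable {F : Type*} [SupertropicalSemifield F] {n : ℕ} {ι κ : Type*}

/-- With the weights `x`, each vector `w i` is strictly dominant, and tangible, in the
coordinate `c i`. -/
def IsSeparating (w : ι → Fin n → F) (c : ι → Fin n) (x : ι → ValueGroup F) : Prop :=
  (∀ i, IsTangible (w i (c i))) ∧ (∀ i, x i ≠ 0) ∧
    ∀ i r, r ≠ i → x r * val F (w r (c i)) < x i * val F (w i (c i))

theorem IsSeparating.injective {w : ι → Fin n → F} {c : ι → Fin n} {x : ι → ValueGroup F}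
    (h : IsSeparating w c x) : Function.Injective c := by
  intro i r e
  by_contra hir
  have h1 := h.2.2 i r (Ne.symm hir)
  have h2 := h.2.2 r i hir
  rw [← e] at h2
  exact lt_asymm h1 h2

/-- For any coefficients, take `i` maximizing `val (α i) / x i`: in column `c i` the term of `i`
strictly dominates and is tangible. -/
theorem IsSeparating.tropIndependent {w : ι → Fin n → F} {c : ι → Fin n} {x : ι → ValueGroup F}
    (h : IsSeparating w c x) : TropIndependent w := by
  rintro ⟨s, α, hs, hα, hg⟩
  obtain ⟨htan, hx0, hlt⟩ := h
  obtain ⟨i, hi, hmax⟩ := s.exists_max_image (fun i => val F (α i) / x i) hs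
  have htan_i : IsTangible (α i * w i (c i)) := isTangible_mul.2 ⟨hα i hi, htan i⟩
  have hsum : ∑ j ∈ s, α j * w j (c i) = α i * w i (c i) := by
    refine sum_eq_of_val_lt hi (fun r hr hri => ?_) htan_i.ne_zero
    have e (j : ι) : val F (α j * w j (c i)) = val F (α j) / x j * (x j * val F (w j (c i))) := by
      rw [map_mul, ← mul_assoc, div_mul_cancel₀ _ (hx0 j)]
    rw [e r, e i]
    refine (mul_le_mul_left (hmax r hr) _).trans_lt ?_
    refine mul_lt_mul_of_pos_left (hlt i r hri) (zero_lt_iff.2 (div_ne_zero ?_ (hx0 i)))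
    exact fun h => (hα i hi).ne_zero (val_eq_zero.1 h)
  have := hg (c i)
  simp only [Finset.sum_apply, Pi.smul_apply, smul_eq_mul] at this
  rw [hsum] at this
  exact htan_i this

/-- A weight vector that makes no tangible entry strictly dominant gives a tropical dependence. -/
theorem tropDependent_of_weights [Fintype ι] (w : ι → Fin n → F) (x : ι → ValueGroup F)
    (hx0 : ∃ j, x j ≠ 0)
    (hx : ∀ j, x j ≠ 0 → ∀ c, IsTangible (w j c) →
      ∃ r, r ≠ j ∧ x j * val F (w j c) ≤ x r * val F (w r c)) : TropDependent w := by
  classical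
  -- Weights are retracted to ghosts and lifted to tangible coefficients; the retraction is
  -- monotone, so the weak inequalities survive.
  have hrep (i : ι) : ∃ t : F, x i ≠ 0 → IsTangible t ∧ ghostMap F t = toGhost F (x i) := by
    by_cases h : x i = 0
    · exact ⟨0, fun h' => absurd h h'⟩
    · obtain ⟨t, ht⟩ := exists_isTangible_ghostMap_eq ((map_ne_zero (toGhost F)).2 h)
      exact ⟨t, fun _ => ht⟩
  choose α hα using hrep
  obtain ⟨k, hk⟩ := hx0
  refine ⟨Finset.univ.filter fun i => x i ≠ 0, α, ⟨k, by simpa using hk⟩,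
    fun i hi => (hα i (Finset.mem_filter.1 hi).2).1, fun c => ?_⟩
  simp only [Finset.sum_apply, Pi.smul_apply, smul_eq_mul]
  by_contra hc
  obtain ⟨i, hi, hs, hlt⟩ := exists_dominant_of_isTangible_sum hc
  have hxi := (Finset.mem_filter.1 hi).2
  have hwi : IsTangible (w i c) := (isTangible_mul.1 (hs ▸ hc : IsTangible (α i * w i c))).2
  obtain ⟨r, hri, hr⟩ := hx i hxi c hwi
  have hxr : x r ≠ 0 := by
    intro h
    rw [h, zero_mul, le_zero_iff, mul_eq_zero, val_eq_zero] at hr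
    exact hr.elim hxi hwi.ne_zero
  have h1 := hlt r (Finset.mem_filter.2 ⟨Finset.mem_univ r, hxr⟩) hri
  have h2 := OrderHomClass.mono (toGhost F) hr
  rw [map_mul, map_mul, toGhost_val, toGhost_val, ← (hα i hxi).2, ← (hα r hxr).2, ← map_mul,
    ← map_mul] at h2
  exact (val_lt_val.1 h1).not_ge h2

/-- A finite family is tropically independent if and only if it can be separated by weights. -/
theorem tropIndependent_iff_exists_isSeparating [Finite ι] {w : ι → Fin n → F} :
    TropIndependent w ↔ ∃ c x, IsSeparating w c x := by
  classical
  have := Fintype.ofFinite ι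
  refine ⟨fun h => ?_, fun ⟨c, x, h⟩ => h.tropIndependent⟩
  rcases exists_subsolution_or_supersolution (fun i c => val F (w i c))
    (fun i => Finset.univ.filter fun c => IsTangible (w i c))
    (fun i c hc h0 => (Finset.mem_filter.1 hc).2.ne_zero (val_eq_zero.1 h0))
    with ⟨x, hx0, hx⟩ | ⟨c, x, hc, hx⟩
  · exact absurd (tropDependent_of_weights w x hx0 fun j hj c hc =>
      hx j hj c (Finset.mem_filter.2 ⟨Finset.mem_univ c, hc⟩)) h
  · exact ⟨c, x, fun i => (Finset.mem_filter.1 (hc i)).2, hx⟩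

theorem TropIndependent.card_le [Fintype ι] {w : ι → Fin n → F} (h : TropIndependent w) :
    Fintype.card ι ≤ n := by
  obtain ⟨c, x, hc⟩ := tropIndependent_iff_exists_isSeparating.1 h
  simpa using Fintype.card_le_of_injective c hc.injective

/-- A nonzero tangible vector can replace some member of a finite tropically independent family. -/
theorem TropIndependent.exists_update [Fintype ι] [Nonempty ι] [DecidableEq ι]
    {w : ι → Fin n → F} (hw : TropIndependent w) {v : Fin n → F} (hv : IsTangibleVec v)
    (hv0 : v ≠ 0) : ∃ i, TropIndependent (Function.update w i v) := by
  obtain ⟨c, x, htan, hx0, hlt⟩ := tropIndependent_iff_exists_isSeparating.1 hw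
  have hval (i) : x i * val F (w i (c i)) ≠ 0 :=
    mul_ne_zero (hx0 i) fun h => (htan i).ne_zero (val_eq_zero.1 h)
  have vtan (d) (h : v d ≠ 0) : IsTangible (v d) := (hv d).resolve_left h
  -- it suffices to choose the row to replace, its new coordinate `d`, and its new weight `y`
  suffices ∃ (i : ι) (d : Fin n) (y : ValueGroup F), v d ≠ 0 ∧ y ≠ 0 ∧
      (∀ r, r ≠ i → x r * val F (w r d) < y * val F (v d)) ∧
      ∀ j, j ≠ i → y * val F (v (c j)) < x j * val F (w j (c j)) by
    obtain ⟨i, d, y, hd, hy, h1, h2⟩ := this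
    refine ⟨i, IsSeparating.tropIndependent (c := Function.update c i d)
      (x := Function.update x i y) ⟨fun j => ?_, fun j => ?_, fun j r hrj => ?_⟩⟩
    · obtain rfl | hj := eq_or_ne j i
      · simpa using vtan d hd
      · simpa [hj] using htan j
    · obtain rfl | hj := eq_or_ne j i
      · simpa using hy
      · simpa [hj] using hx0 j
    · obtain rfl | hj := eq_or_ne j i
      · simpa [hrj] using h1 r hrj
      · obtain rfl | hr := eq_or_ne r i
        · simpa [hj] using h2 j hj
        · simpa [hj, hr] using hlt j r hrj
  by_cases hc : ∃ j, v (c j) ≠ 0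
  · obtain ⟨j₀, hj₀⟩ := hc
    -- The row to replace is the one where `v` is largest relative to the weighted diagonal entry.
    let m : ι → ValueGroup F := fun j => val F (v (c j)) / (x j * val F (w j (c j)))
    obtain ⟨i, -, hmax⟩ := Finset.univ.exists_max_image m ⟨j₀, Finset.mem_univ j₀⟩
    have hm : 0 < m i := (zero_lt_iff.2 (div_ne_zero (fun h => hj₀ (val_eq_zero.1 h))
      (hval j₀))).trans_le (hmax j₀ (Finset.mem_univ j₀))
    have hvi : val F (v (c i)) ≠ 0 := fun h => hm.ne' (by simp only [m, h, zero_div])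
    -- The weighted entry of `v` in column `c i` is put strictly below the old diagonal entry, so
    -- that `v` stays strictly below the other diagonals even if the maximum of `m` is attained more
    -- than once.
    obtain ⟨z, hz0, hz1, hz2⟩ := exists_ne_zero_between (Finset.univ.erase i) {i}
      (fun r => x r * val F (w r (c i))) (fun r => x r * val F (w r (c i)))
      (fun r hr j hj => by
        rw [Finset.mem_singleton] at hj
        subst hj
        exact hlt j r (Finset.ne_of_mem_erase hr))
      (fun j hj => by
        rw [Finset.mem_singleton] at hj
        subst hj
        exact zero_lt_iff.2 (hval j))
    refine ⟨i, c i, z / val F (v (c i)), fun h => hvi (val_eq_zero.2 h), div_ne_zero hz0 hvi,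
      fun r hr => ?_, fun j hj => ?_⟩
    · rw [div_mul_cancel₀ _ hvi]
      exact hz1 r (Finset.mem_erase.2 ⟨hr, Finset.mem_univ r⟩)
    · have hle : val F (v (c j)) ≤ m i * (x j * val F (w j (c j))) :=
        (div_le_iff₀ (zero_lt_iff.2 (hval j))).1 (hmax j (Finset.mem_univ j))
      have hlt' : z / val F (v (c i)) * m i < 1 := by
        simp only [m]
        rw [div_mul_div_cancel₀ hvi, div_lt_one₀ (zero_lt_iff.2 (hval i))]
        exact hz2 i (Finset.mem_singleton_self i)
      calc z / val F (v (c i)) * val F (v (c j))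
          ≤ z / val F (v (c i)) * (m i * (x j * val F (w j (c j)))) := mul_le_mul_right hle _
        _ = z / val F (v (c i)) * m i * (x j * val F (w j (c j))) := (mul_assoc _ _ _).symm
        _ < x j * val F (w j (c j)) := mul_lt_of_lt_one_left (zero_lt_iff.2 (hval j)) hlt'
  -- If `v` vanishes in all separating columns, any row may be replaced, with a weight large enough
  -- to dominate a column where `v` is nonzero.
  · push Not at hc
    obtain ⟨d, hd⟩ := Function.ne_iff.1 hv0
    have hvd : val F (v d) ≠ 0 := fun h => hd (val_eq_zero.1 h)
    obtain ⟨z, hz0, hz1, -⟩ := exists_ne_zero_between Finset.univ ∅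
      (fun r => x r * val F (w r d)) 0 (by simp) (by simp)
    refine ⟨Classical.arbitrary ι, d, z / val F (v d), hd, div_ne_zero hz0 hvd,
      fun r _ => ?_, fun j _ => ?_⟩
    · rw [div_mul_cancel₀ _ hvd]
      exact hz1 r (Finset.mem_univ r)
    · rw [hc j, map_zero, mul_zero]
      exact zero_lt_iff.2 (hval j)

theorem TropIndependent.comp {w : ι → Fin n → F} (hw : TropIndependent w) {f : κ → ι}
    (hf : Function.Injective f) : TropIndependent (w ∘ f) := by
  rintro ⟨s, α, hs, hα, hg⟩
  refine hw ⟨s.map ⟨f, hf⟩, Function.extend f α 0, hs.map, ?_, ?_⟩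
  · intro i hi
    obtain ⟨j, hj, rfl⟩ := Finset.mem_map.1 hi
    simpa [hf.extend_apply] using hα j hj
  · simpa [hf.extend_apply] using hg

theorem TropIndependent.injective {w : ι → Fin n → F} (hw : TropIndependent w) :
    Function.Injective w := by
  classical
  intro i j e
  by_contra hij
  refine hw ⟨{i, j}, 1, ⟨i, by simp⟩, fun _ _ => one_tangible, fun c => ?_⟩
  rw [Finset.sum_pair hij, e]
  simpa using nu_mem_ghost (w j c)

theorem TropIndependent.range {w : ι → Fin n → F} (hw : TropIndependent w) :
    TropIndependentSet (Set.range w) := by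
  have h := hw.comp (Equiv.ofInjective w hw.injective).symm.injective
  have e : w ∘ (Equiv.ofInjective w hw.injective).symm = fun y : Set.range w => y.1 := by
    funext y
    exact Equiv.apply_ofInjective_symm hw.injective y
  rwa [e] at h

theorem TropIndependentSet.mono {S T : Set (Fin n → F)} (hT : TropIndependentSet T)
    (h : S ⊆ T) : TropIndependentSet S :=
  TropIndependent.comp hT (Set.inclusion_injective h)

theorem TropIndependentSet.encard_le {S : Set (Fin n → F)} (hS : TropIndependentSet S) :
    S.encard ≤ n := by
  by_contra! h
  obtain ⟨T, hTS, hT⟩ := Set.exists_subset_encard_eq (Order.add_one_le_of_lt h)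
  have hfin : T.Finite := Set.finite_of_encard_eq_coe (k := n + 1) (by exact_mod_cast hT)
  have := hfin.fintype
  have hcard := TropIndependent.card_le (hS.mono hTS)
  rw [← Set.coe_fintypeCard] at hT
  have hT' : Fintype.card T = n + 1 := by exact_mod_cast hT
  omega

theorem TropIndependentSet.finite {S : Set (Fin n → F)} (hS : TropIndependentSet S) : S.Finite :=
  Set.finite_of_encard_le_coe hS.encard_le

/-- A tropically independent set is the range of a tropically independent family. -/
theorem TropIndependentSet.exists_family {S : Set (Fin n → F)} (hS : TropIndependentSet S)
    {k : ℕ} (hk : S.encard = k) :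
    ∃ w : Fin k → Fin n → F, TropIndependent w ∧ Set.range w = S := by
  have := hS.finite.fintype
  rw [← Set.coe_fintypeCard, Nat.cast_inj] at hk
  let e := (Fintype.equivFinOfCardEq hk).symm
  refine ⟨Subtype.val ∘ e, TropIndependent.comp hS e.injective, ?_⟩
  rw [Set.range_comp, e.surjective.range_eq, Set.image_univ, Subtype.range_coe]

theorem TropIndependent.encard_range {k : ℕ} {w : Fin k → Fin n → F} (hw : TropIndependent w) :
    (Set.range w).encard = k := by
  rw [← Set.image_univ, hw.injective.encard_image, Set.encard_univ]
  simp

theorem tropIndependentSet_singleton {v : Fin n → F} (hv : IsTangibleVec v) (hv0 : v ≠ 0) :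
    TropIndependentSet {v} := by
  obtain ⟨d, hd⟩ := Function.ne_iff.1 hv0
  have : IsSeparating (fun _ : Unit => v) (fun _ => d) (fun _ => 1) :=
    ⟨fun _ => (hv d).resolve_left hd, fun _ => one_ne_zero, fun _ _ h => absurd rfl h⟩
  simpa using this.tropIndependent.range

/-- A nonzero tangible vector of a subspace belongs to a largest tropically independent set of
tangible vectors of the subspace. -/
theorem exists_largest_tangible_independent (V : Submodule F (Fin n → F)) {v : Fin n → F}
    (hvV : v ∈ V) (hv : IsTangibleVec v) (hv0 : v ≠ 0) :
    ∃ B : Set (Fin n → F), B ⊆ (V : Set (Fin n → F)) ∧ (∀ b ∈ B, IsTangibleVec b) ∧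
      TropIndependentSet B ∧ v ∈ B ∧
      ∀ C : Set (Fin n → F), C ⊆ (V : Set (Fin n → F)) → (∀ c ∈ C, IsTangibleVec c) →
        TropIndependentSet C → C.encard ≤ B.encard := by
  let K : Set ℕ := {k | ∃ C : Set (Fin n → F), C ⊆ (V : Set (Fin n → F)) ∧
    (∀ c ∈ C, IsTangibleVec c) ∧ TropIndependentSet C ∧ C.encard = k}
  have h1 : 1 ∈ K := ⟨{v}, by simpa using hvV, by simpa using hv,
    tropIndependentSet_singleton hv hv0, by simp⟩
  have hbdd : BddAbove K := by
    refine ⟨n, ?_⟩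
    rintro k ⟨C, -, -, hC, hk⟩
    have := hC.encard_le
    rw [hk] at this
    exact_mod_cast this
  -- The successor form makes the index type `Fin (m + 1)` nonempty, as the exchange requires.
  obtain ⟨m, hm⟩ : ∃ m, sSup K = m + 1 :=
    Nat.exists_eq_succ_of_ne_zero (Nat.one_le_iff_ne_zero.1 (le_csSup hbdd h1))
  have hmem := Nat.sSup_mem ⟨1, h1⟩ hbdd
  rw [hm] at hmem
  obtain ⟨C, hCV, hCt, hC, hk⟩ := hmem
  obtain ⟨w, hw, rfl⟩ := hC.exists_family hk
  obtain ⟨i, hi⟩ := hw.exists_update hv hv0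
  have hmem' (p : (Fin n → F) → Prop) (hpv : p v) (hpw : ∀ j, p (w j)) :
      ∀ b ∈ Set.range (Function.update w i v), p b := by
    rintro _ ⟨j, rfl⟩
    obtain rfl | hj := eq_or_ne j i
    · rwa [Function.update_self]
    · rw [Function.update_of_ne hj]
      exact hpw j
  refine ⟨Set.range (Function.update w i v), hmem' (· ∈ V) hvV fun j => hCV ⟨j, rfl⟩,
    hmem' _ hv fun j => hCt _ ⟨j, rfl⟩, hi.range, ⟨i, Function.update_self i v w⟩, ?_⟩
  intro D hDV hDt hD
  obtain ⟨d, hd⟩ := ENat.ne_top_iff_exists.1 (Set.encard_ne_top_iff.2 hD.finite)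
  rw [hi.encard_range, ← hd, ← hm]
  exact_mod_cast le_csSup hbdd ⟨D, hDV, hDt, hD, hd.symm⟩

theorem add_eq_left_of_isTangible {a b : F} (h : IsTangible (a + b))
    (hb : b ∈ ghost (F := F)) : a + b = a := by
  rcases lt_trichotomy (val F b) (val F a) with e | e | e
  · exact add_eq_left_of_val_lt e
  · exact absurd (add_mem_ghost_of_val_eq e.symm) h
  · rw [add_eq_right_of_val_lt e] at h
    exact absurd hb h

/-- A finite tropically independent family in a tropical subspace can be replaced by a tropically
independent family of tangible vectors: each vector is replaced by the summand of a tropical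
combination that dominates in its separating coordinate. -/
theorem IsTropicalSubspace.exists_tangible_independent [Finite ι] {V : Submodule F (Fin n → F)}
    (hV : IsTropicalSubspace V) {w : ι → Fin n → F} (hwV : ∀ i, w i ∈ V)
    (hw : TropIndependent w) :
    ∃ w' : ι → Fin n → F, (∀ i, w' i ∈ V) ∧ (∀ i, IsTangibleVec (w' i)) ∧
      TropIndependent w' := by
  obtain ⟨S, hSV, hSt, hspan⟩ := hV
  obtain ⟨c, x, htan, hx0, hlt⟩ := tropIndependent_iff_exists_isSeparating.1 hw
  have key (i : ι) : ∃ z ∈ V, IsTangibleVec z ∧ z (c i) = w i (c i) ∧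
      ∀ d, val F (z d) ≤ val F (w i d) := by
    obtain ⟨s, α, u, -, hs, hα, hu, e⟩ := hspan (w i) (hwV i)
    have he (d) : w i d = ∑ t ∈ s, α t * t d + u d := by
      rw [e]
      simp
    have htan_i := htan i
    rw [he] at htan_i
    -- The entry at `c i` is tangible, so the ghost part does not contribute and a single summand
    -- gives its exact value.
    have h1 := add_eq_left_of_isTangible htan_i (hu _)
    rw [h1] at htan_i
    obtain ⟨t, ht, h2, -⟩ := exists_dominant_of_isTangible_sum htan_i
    refine ⟨α t • t, V.smul_mem _ (hSV (hs ht)), fun d => ?_, ?_, fun d => ?_⟩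
    · rcases hSt t (hs ht) d with h | h
      · left
        simp [h]
      · exact Or.inr (isTangible_mul.2 ⟨hα t ht, h⟩)
    · rw [he, h1, h2]
      rfl
    · rw [he]
      exact (val_le_val_sum (fun t => α t * t d) ht).trans (val_le_val_add_left _ _)
  choose w' hw'V hw't hw'c hw'le using key
  refine ⟨w', hw'V, hw't, IsSeparating.tropIndependent (c := c) (x := x)
    ⟨fun i => by rw [hw'c]; exact htan i, hx0, fun i r hri => ?_⟩⟩
  rw [hw'c i]
  exact (mul_le_mul_right (hw'le r (c i)) _).trans_lt (hlt i r hri)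

/-- A nonzero tangible vector of a tropical subspace belongs to a tangible d-base of largest
rank. -/
theorem IsTropicalSubspace.exists_tangible_isDBase {V : Submodule F (Fin n → F)}
    (hV : IsTropicalSubspace V) {v : Fin n → F} (hvV : v ∈ V) (hv : IsTangibleVec v)
    (hv0 : v ≠ 0) :
    ∃ B : Set (Fin n → F), IsDBase V B ∧ (∀ b ∈ B, IsTangibleVec b) ∧ v ∈ B ∧
      B.encard = rk V := by
  obtain ⟨B, hBV, hBt, hB, hvB, hmax⟩ := exists_largest_tangible_independent V hvV hv hv0
  have hle (C : Set (Fin n → F)) (hCV : C ⊆ V) (hC : TropIndependentSet C) :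
      C.encard ≤ B.encard := by
    obtain ⟨k, hk⟩ := ENat.ne_top_iff_exists.1 (Set.encard_ne_top_iff.2 hC.finite)
    obtain ⟨w, hw, rfl⟩ := hC.exists_family hk.symm
    obtain ⟨w', hw'V, hw't, hw'⟩ := hV.exists_tangible_independent (fun i => hCV ⟨i, rfl⟩) hw
    rw [hw.encard_range, ← hw'.encard_range]
    exact hmax _ (Set.range_subset_iff.2 hw'V) (Set.forall_mem_range.2 hw't) hw'.range
  have hbase : IsDBase V B := ⟨⟨hBV, hB⟩, fun C hC hBC =>
    (hB.finite.eq_of_subset_of_encard_le hBC (hle C hC.1 hC.2)).ge⟩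
  exact ⟨B, hbase, hBt, hvB, le_antisymm (le_iSup₂ (f := fun C (_ : IsDBase V C) => C.encard)
    B hbase) (iSup₂_le fun C hC => hle C hC.prop.1 hC.prop.2)⟩

end Independence

end Supertropical

theorem proposition4 {F : Type*} [SupertropicalSemifield F] (n : ℕ) :
    -- exchange: a nonzero tangible vector can replace one member of an independent family
    (∀ (k : ℕ) (w : Fin (k + 1) → Fin n → F) (v : Fin n → F),
      Supertropical.TropIndependent w → Supertropical.IsTangibleVec v → v ≠ 0 →
        ∃ i : Fin (k + 1), Supertropical.TropIndependent (Function.update w i v)) ∧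
    -- every subspace: a tangible independent subset through `v`, largest among the tangible ones
    (∀ (V : Submodule F (Fin n → F)) (v : Fin n → F),
      v ∈ V → Supertropical.IsTangibleVec v → v ≠ 0 →
        ∃ B : Set (Fin n → F), B ⊆ (V : Set (Fin n → F)) ∧ (∀ b ∈ B, Supertropical.IsTangibleVec b) ∧
          Supertropical.TropIndependentSet B ∧ v ∈ B ∧
          ∀ C : Set (Fin n → F), C ⊆ (V : Set (Fin n → F)) →
            (∀ c ∈ C, Supertropical.IsTangibleVec c) → Supertropical.TropIndependentSet C →
              C.encard ≤ B.encard) ∧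
    -- tropical subspaces: a tangible d-base through `v` of rank `rk V`
    (∀ (V : Submodule F (Fin n → F)) (v : Fin n → F),
      Supertropical.IsTropicalSubspace V → v ∈ V → Supertropical.IsTangibleVec v → v ≠ 0 →
        ∃ B : Set (Fin n → F), Supertropical.IsDBase V B ∧
          (∀ b ∈ B, Supertropical.IsTangibleVec b) ∧ v ∈ B ∧
          B.encard = Supertropical.rk V) :=
  ⟨fun _ _ _ hw hv hv0 => hw.exists_update hv hv0,
    fun V _ hvV hv hv0 => Supertropical.exists_largest_tangible_independent V hvV hv hv0,
    fun _ _ hV hvV hv hv0 => hV.exists_tangible_isDBase hvV hv hv0⟩
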